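/- Let $\alpha\in(0,1)$ be irrational and let $\Xi\subset\{0,1\}^{\mathbb N}$ be the (right-infinite) Sturmian subshift associated to $\alpha$, i.e. the closure, for the product topology, of the set of sequences $(\chi_{[1-\alpha,1)}(n\alpha+\rho \bmod 1))_{n\ge 0}$, $\rho\in\mathbb R$. Let $\mathcal L$ be its language, the set of all finite words (including the empty word) occurring in elements of $\Xi$, and write $|u|$ for the length of a word $u$. A complete first return to a non-empty word $u\in\mathcal L$ is a word $u'\in\mathcal L$ that has $u$ as a prefix and as a suffix and contains exactly two occurrences of $u$; the complete first returns to the empty word are by definition the letters. A word is privileged if it is obtained from the empty word by finitely many (possibly zero) iterations of taking complete first returns. A word $r$ is right-special if $ra,rb\in\mathcal L$ for two distinct letters $a\ne b$. For a privileged word $u$ let $\phi^{(0)}(u)$ be the shortest right-special word having $u$ as a prefix. A weight function is a strictly decreasing function $\delta:\mathbb Z\to(0,\infty)$ with $\delta(n)\to 0$ as $n\to+\infty$, for which there are constants $\overline c,\underline c>0$ such that $\delta(ab)\le\overline c\,\delta(a)\delta(b)$ for all integers $a,b\ge 1$ and $\delta(2a)\ge\underline c\,\delta(a)$ for all integers $a$.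 The subshift $\Xi$ is linearly recurrent if there is a constant $C$ such that, in every element of $\Xi$, every occurrence of a non-empty word $u\in\mathcal L$ is followed by another occurrence of $u$, the next one being at distance at most $C|u|$. Then, for every weight function $\delta$, the following are equivalent: (a) the function $u\mapsto \delta(|u|)/\delta(|\phi^{(0)}(u)|)$ is bounded on the set of privileged words of $\Xi$; (b) $\Xi$ is linearly recurrent; (c) the coefficients $a_1,a_2,\dots$ of the continued fraction expansion $\alpha=[0;a_1,a_2,\dots]$ are bounded. -/

import Mathlib

open Filter Topology SymbolicDynamics.FullShift

namespace SturmianWeights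

section Words

variable {A : Type*}

/-- The finite word `w` occurs at position `i` in the right-infinite word `ξ`. -/
def OccursAt (ξ : ℕ → A) (w : List A) (i : ℕ) : Prop :=
  ∀ k : Fin w.length, ξ (i + k) = w.get k

/-- The set of positions at which the word `u` occurs in the finite word `w`. -/
def occurrences (u w : List A) : Set ℕ :=
  {i | i + u.length ≤ w.length ∧ u <+: w.drop i}

variable [TopologicalSpace A]

/-- The language of a right-infinite subshift: all finite words (including the empty one)
occurring in some element of the subshift. -/
def language (X : Subshift A ℕ) : Set (List A) :=
  {w | ∃ ξ ∈ X.carrier, ∃ i, OccursAt ξ w i}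

/-- `u'` is a complete first return to `u`: a non-empty word of the language having `u` as a
prefix and as a suffix and containing exactly two occurrences of `u`. The complete first returns
to the empty word are, by convention, the letters. -/
def IsCompleteFirstReturn (X : Subshift A ℕ) (u u' : List A) : Prop :=
  u' ∈ language X ∧
    ((u = [] ∧ u'.length = 1) ∨
      (u ≠ [] ∧ u <+: u' ∧ u <:+ u' ∧ (occurrences u u').ncard = 2))

/-- The privileged words: the iterated complete first returns of the empty word. -/
inductive IsPrivileged (X : Subshift A ℕ) : List A → Prop
  | nil : IsPrivileged X []
  | ret {u u' : List A} : IsPrivileged X u → IsCompleteFirstReturn X u u' → IsPrivileged X u'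

/-- `r` is right-special: it has at least two distinct one-letter right extensions. -/
def IsRightSpecial (X : Subshift A ℕ) (r : List A) : Prop :=
  ∃ a b : A, a ≠ b ∧ r ++ [a] ∈ language X ∧ r ++ [b] ∈ language X

/-- `r` is a right-special word with prefix `u`, and has the least length among all such words. -/
def IsShortestRightSpecialExtension (X : Subshift A ℕ) (u r : List A) : Prop :=
  IsRightSpecial X r ∧ u <+: r ∧
    ∀ r' : List A, IsRightSpecial X r' → u <+: r' → r.length ≤ r'.length

/-- `φ⁰(u)`: the shortest right-special word having `u` as a prefix (unique when it exists, and it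
always exists in a minimal aperiodic subshift). -/
noncomputable def phiZero (X : Subshift A ℕ) (u : List A) : List A :=
  Classical.epsilon (IsShortestRightSpecialExtension X u)

theorem phiZero_spec {X : Subshift A ℕ} {u r : List A}
    (h : IsShortestRightSpecialExtension X u r) :
    IsShortestRightSpecialExtension X u (phiZero X u) :=
  Classical.epsilon_spec ⟨r, h⟩

theorem length_phiZero {X : Subshift A ℕ} {u r : List A}
    (h : IsShortestRightSpecialExtension X u r) : (phiZero X u).length = r.length :=
  le_antisymm ((phiZero_spec h).2.2 r h.1 h.2.1)
    (h.2.2 _ (phiZero_spec h).1 (phiZero_spec h).2.1)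

/-- A right-infinite subshift is linearly recurrent if for some constant `C`, every occurrence of
a non-empty word `u` of the language in an element of the subshift is followed by another one at
distance at most `C * |u|`. -/
def IsLinearlyRecurrent (X : Subshift A ℕ) : Prop :=
  ∃ C : ℝ, ∀ u ∈ language X, u ≠ [] → ∀ ξ ∈ X.carrier, ∀ i, OccursAt ξ u i →
    ∃ j, i < j ∧ OccursAt ξ u j ∧ ((j : ℝ) - i) ≤ C * u.length

end Words

/-- Weight functions. The submultiplicativity up to a constant is required at positive integers
(requiring it at `a = 0` would contradict `δ → 0`). -/
structure IsWeightFunction (δ : ℤ → ℝ) : Prop where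
  pos : ∀ a, 0 < δ a
  strictAnti : StrictAnti δ
  tendsto_zero : Tendsto δ atTop (𝓝 0)
  mul_le : ∃ c : ℝ, 0 < c ∧ ∀ a b : ℤ, 0 < a → 0 < b → δ (a * b) ≤ c * δ a * δ b
  le_two_mul : ∃ c : ℝ, 0 < c ∧ ∀ a : ℤ, c * δ a ≤ δ (2 * a)

/-- The boundedness condition: `u ↦ δ(|u|) / δ(|φ⁰(u)|)` is bounded on the privileged words. -/
def HasBoundedWeightRatio {A : Type*} [TopologicalSpace A] (X : Subshift A ℕ) (δ : ℤ → ℝ) : Prop :=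
  BddAbove {t : ℝ | ∃ u : List A, IsPrivileged X u ∧
    t = δ (u.length : ℤ) / δ ((phiZero X u).length : ℤ)}

/-- The coding of the orbit of `ρ` under the rotation by `α` on `ℝ/ℤ`, with respect to the
interval `[1 - α, 1)`: the `n`-th letter is `1` iff `n α + ρ mod 1` lies in `[1 - α, 1)`. -/
noncomputable def rotationWord (α ρ : ℝ) : ℕ → Fin 2 :=
  fun n => if Int.fract (n * α + ρ) < 1 - α then 0 else 1

theorem shift_rotationWord (g : ℕ) (α ρ : ℝ) :
    shift g (rotationWord α ρ) = rotationWord α (ρ + g * α) := by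
  funext n
  simp only [shift_apply, rotationWord]
  have h : ((g + n : ℕ) : ℝ) * α + ρ = n * α + (ρ + g * α) := by push_cast; ring
  rw [h]

/-- The (right-infinite) Sturmian subshift with rotation number `α` over the alphabet `{0, 1}`:
the closure, in the product of the discrete topologies, of the set of all codings of rotation
orbits. -/
noncomputable def sturmianSubshift (α : ℝ) : Subshift (Fin 2) ℕ where
  carrier := closure (Set.range (rotationWord α))
  isClosed := isClosed_closure
  mapsTo := fun g => by
    refine Set.MapsTo.closure ?_ (continuous_shift g)
    rintro _ ⟨ρ, rfl⟩
    exact ⟨ρ + g * α, (shift_rotationWord g α ρ).symm⟩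

/-- The partial quotients `a₁, a₂, …` of the continued fraction expansion of `α` are bounded. -/
def HasBoundedPartialQuotients (α : ℝ) : Prop :=
  BddAbove {b : ℝ | ∃ n, (GenContFract.of α).partDens.get? n = some b}

end SturmianWeights

namespace SturmianWeights

open GenContFract in
theorem exists_int_contsAux (α : ℝ) (n : ℕ) :
    ∃ p q : ℤ, ((GenContFract.of α).contsAux n).a = p ∧ ((GenContFract.of α).contsAux n).b = q := by
  induction n using Nat.twoStepInduction with
  | zero => exact ⟨1, 0, by simp [contsAux], by simp [contsAux]⟩
  | one => exact ⟨⌊α⌋, 1, by simp [contsAux], by simp [contsAux]⟩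
  | more n ih₀ ih₁ =>
    obtain ⟨p₀, q₀, hp₀, hq₀⟩ := ih₀
    obtain ⟨p₁, q₁, hp₁, hq₁⟩ := ih₁
    rcases h : (GenContFract.of α).s.get? n with _ | gp
    · exact ⟨p₁, q₁, by simpa [contsAux, h] using hp₁, by simpa [contsAux, h] using hq₁⟩
    · obtain ⟨ha, z, hz⟩ := of_partNum_eq_one_and_exists_int_partDen_eq h
      rw [contsAux_recurrence h rfl rfl, hp₀, hq₀, hp₁, hq₁, ha, hz]
      exact ⟨z * p₁ + p₀, z * q₁ + q₀, by push_cast; ring, by push_cast; ring⟩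

open GenContFract in
theorem exists_stream_eq_some {α : ℝ} (hα : Irrational α) (n : ℕ) :
    ∃ f : IntFractPair ℝ, IntFractPair.stream α n = some f ∧ f.fr ≠ 0 := by
  have key : ∀ n, IntFractPair.stream α (n + 1) ≠ none := by
    intro n h
    have ht : (GenContFract.of α).Terminates :=
      ⟨n, of_terminatedAt_n_iff_succ_nth_intFractPair_stream_eq_none.2 h⟩
    obtain ⟨q, hq⟩ := (terminates_iff_rat α).1 ht
    exact hα ⟨q, hq.symm⟩
  obtain ⟨g, hg⟩ := Option.ne_none_iff_exists'.1 (key n)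
  obtain ⟨f, hf, hf0, -⟩ := IntFractPair.succ_nth_stream_eq_some_iff.1 hg
  exact ⟨f, hf, hf0⟩

open GenContFract in
/-- The continued fraction convergents of an irrational number, with integral numerators and
denominators and two-sided bounds for the approximation errors. -/
theorem exists_convergents {α : ℝ} (hα : Irrational α) :
    ∃ (p q : ℕ → ℤ) (a : ℕ → ℝ), (∀ n, (GenContFract.of α).partDens.get? n = some (a n)) ∧
      q 0 = 1 ∧ (∀ n : ℕ, (n : ℤ) ≤ q n) ∧ (∀ n, 1 ≤ q n) ∧ (∀ n, q n ≤ q (n + 1)) ∧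
      (∀ n, a n * q n ≤ q (n + 1)) ∧ (∀ n, (q (n + 1) : ℝ) ≤ (a n + 1) * q n) ∧
      (∀ n, 0 < (-1) ^ n * (q n * α - p n)) ∧
      (∀ n, 1 / ((q n : ℝ) + q (n + 1)) ≤ |q n * α - p n|) ∧
      (∀ n, |q n * α - p n| ≤ 1 / (q (n + 1) : ℝ)) := by
  choose P Q hP hQ using exists_int_contsAux α
  choose f hf hf0 using exists_stream_eq_some hα
  have hsucc : ∀ n, f (n + 1) = IntFractPair.of (f n).fr⁻¹ := fun n => by
    have := IntFractPair.stream_succ_of_some (hf n) (hf0 n)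
    rw [hf (n + 1)] at this
    exact Option.some.inj this
  have hs : ∀ n, (GenContFract.of α).s.get? n = some ⟨1, ((f (n + 1)).b : ℝ)⟩ := fun n =>
    get?_of_eq_some_of_succ_get?_intFractPair_stream (hf (n + 1))
  have hd : ∀ n, (GenContFract.of α).partDens.get? n = some ((f (n + 1)).b : ℝ) := fun n =>
    partDen_eq_s_b (hs n)
  have hb1 : ∀ n, 1 ≤ (f (n + 1)).b := fun n => IntFractPair.one_le_succ_nth_stream_b (hf (n + 1))
  have hrec : ∀ n, Q (n + 2) = (f (n + 1)).b * Q (n + 1) + Q n := fun n => by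
    have h := congrArg Pair.b (contsAux_recurrence (hs n) rfl rfl)
    rw [hQ] at h
    simp only [hQ, one_mul] at h
    exact_mod_cast h
  have hQ0 : Q 0 = 0 := by
    have := hQ 0
    simp only [contsAux] at this
    exact_mod_cast this.symm
  have hQ1 : Q 1 = 1 := by
    have := hQ 1
    simp only [contsAux] at this
    exact_mod_cast this.symm
  have hmono : ∀ n, 0 ≤ Q n ∧ 1 ≤ Q (n + 1) ∧ Q n ≤ Q (n + 1) := by
    intro n
    induction n with
    | zero => simp [hQ0, hQ1]
    | succ n ih =>
      refine ⟨by linarith, ?_, ?_⟩ <;> rw [hrec] <;> nlinarith [hb1 n]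
  have hgrow : ∀ n : ℕ, (n : ℤ) ≤ Q (n + 1) ∧ ((n : ℤ) + 1) ≤ Q (n + 2) := by
    intro n
    induction n with
    | zero =>
      have := (hmono 1).2.1
      exact ⟨by simp [hQ1], by simpa using this⟩
    | succ n ih =>
      refine ⟨by push_cast; exact ih.2, ?_⟩
      have := hrec (n + 1)
      have h1 := hb1 (n + 1)
      have h2 := (hmono n).2.1
      have h3 := (hmono (n + 1)).2.1
      have h4 := ih.2
      push_cast
      show (n : ℤ) + 1 + 1 ≤ Q (n + 1 + 2)
      rw [this]
      have h5 : Q (n + 1 + 1) = Q (n + 2) := rfl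
      nlinarith
  have herr : ∀ n, (-1) ^ n * (Q (n + 1) * α - P (n + 1))
      = 1 / ((f n).fr⁻¹ * Q (n + 1) + Q n) := by
    intro n
    have h := sub_convs_eq (hf n)
    simp only [hf0 n, if_false, conv_eq_conts_a_div_conts_b, nth_cont_eq_succ_nth_contAux, hP,
      hQ] at h
    have hq : (Q (n + 1) : ℝ) ≠ 0 := by
      have := (hmono n).2.1
      exact_mod_cast (by omega : Q (n + 1) ≠ 0)
    have h' : (Q (n + 1) * α - P (n + 1)) = (-1) ^ n / ((f n).fr⁻¹ * Q (n + 1) + Q n) := by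
      have : (Q (n + 1) * α - P (n + 1)) = Q (n + 1) * (α - P (n + 1) / Q (n + 1)) := by
        field_simp
      rw [this, h, mul_div_assoc', mul_div_mul_left _ _ hq]
    rw [h', mul_div_assoc', ← pow_add, Even.neg_one_pow ⟨n, rfl⟩]
  have hfl : ∀ n, ((f (n + 1)).b : ℝ) ≤ (f n).fr⁻¹ ∧ (f n).fr⁻¹ < (f (n + 1)).b + 1 := fun n => by
    rw [hsucc n]
    exact ⟨Int.floor_le _, Int.lt_floor_add_one _⟩
  have hrecR : ∀ n, (Q (n + 2) : ℝ) = (f (n + 1)).b * Q (n + 1) + Q n := fun n => by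
    rw [hrec]; push_cast; ring
  have hR : ∀ n, (0 : ℝ) ≤ Q n ∧ (1 : ℝ) ≤ Q (n + 1) ∧ (Q n : ℝ) ≤ Q (n + 1) := fun n => by
    exact_mod_cast hmono n
  have hbR : ∀ n, (1 : ℝ) ≤ (f (n + 1)).b := fun n => by exact_mod_cast hb1 n
  have hpos : ∀ n, 0 < (-1) ^ n * (Q (n + 1) * α - P (n + 1)) := fun n => by
    rw [herr]
    obtain ⟨h1, h2, h3⟩ := hR n
    have h4 := hfl n
    have h5 := hbR n
    apply one_div_pos.2
    nlinarith
  have habs : ∀ n, |Q (n + 1) * α - P (n + 1)| = 1 / ((f n).fr⁻¹ * Q (n + 1) + Q n) := fun n => by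
    rw [← herr, ← abs_of_pos (hpos n), abs_mul, abs_pow, abs_neg, abs_one, one_pow, one_mul]
  refine ⟨fun n => P (n + 1), fun n => Q (n + 1), fun n => ((f (n + 1)).b : ℝ), hd, hQ1,
    fun n => (hgrow n).1, fun n => (hmono n).2.1, fun n => (hmono (n + 1)).2.2, ?_, ?_, hpos, ?_, ?_⟩
  · intro n
    show _ ≤ (Q (n + 2) : ℝ)
    rw [hrecR]
    linarith [(hR n).1]
  · intro n
    show (Q (n + 2) : ℝ) ≤ _
    rw [hrecR]
    linarith [(hR n).2.2]
  · intro n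
    rw [habs]
    show 1 / ((Q (n + 1) : ℝ) + Q (n + 2)) ≤ _
    rw [hrecR]
    obtain ⟨h1, h2, h3⟩ := hR n
    have h4 := hfl n
    have h5 := hbR n
    apply one_div_le_one_div_of_le <;> nlinarith
  · intro n
    rw [habs]
    show _ ≤ 1 / (Q (n + 2) : ℝ)
    rw [hrecR]
    obtain ⟨h1, h2, h3⟩ := hR n
    have h4 := hfl n
    have h5 := hbR n
    apply one_div_le_one_div_of_le <;> nlinarith

/-- `α` is badly approximable: the approximation errors `|q α - p|` are at least of order
`1 / q`. -/
def IsBadlyApproximable (α : ℝ) : Prop :=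
  ∃ c : ℝ, 0 < c ∧ ∀ q p : ℤ, 1 ≤ q → c ≤ q * |q * α - p|

theorem IsBadlyApproximable.hasBoundedPartialQuotients {α : ℝ} (hα : Irrational α)
    (h : IsBadlyApproximable α) : HasBoundedPartialQuotients α := by
  obtain ⟨c, hc, h⟩ := h
  obtain ⟨p, q, a, ha, -, -, hq1, -, haq, -, -, -, herr⟩ := exists_convergents hα
  refine ⟨1 / c, ?_⟩
  rintro b ⟨n, hn⟩
  obtain rfl : a n = b := by
    rw [ha n] at hn
    exact Option.some.inj hn
  have hq : (1 : ℝ) ≤ q n := by exact_mod_cast hq1 n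
  have hq' : (1 : ℝ) ≤ q (n + 1) := by exact_mod_cast hq1 (n + 1)
  have h1 := h (q n) (p n) (hq1 n)
  have h2 := herr n
  have h3 : c * q (n + 1) ≤ q n := by
    have h4 : q n * |q n * α - p n| ≤ q n * (1 / (q (n + 1) : ℝ)) := by gcongr
    have h5 := h1.trans h4
    rwa [mul_one_div, le_div_iff₀ (by linarith)] at h5
  rw [le_div_iff₀ hc]
  have h6 := haq n
  have h7 : c * (a n * q n) ≤ 1 * q n := by nlinarith
  nlinarith

theorem HasBoundedPartialQuotients.isBadlyApproximable {α : ℝ} (hα : Irrational α)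
    (h : HasBoundedPartialQuotients α) : IsBadlyApproximable α := by
  obtain ⟨M, hM⟩ := h
  obtain ⟨p, q, a, ha, hq0, hqn, hq1, hqm, -, hqa, -, hlow, herr⟩ := exists_convergents hα
  have haM : ∀ n, a n ≤ M := fun n => hM ⟨n, ha n⟩
  have hqR : ∀ n, (1 : ℝ) ≤ q n := fun n => by exact_mod_cast hq1 n
  have hM0 : 0 ≤ M + 1 := by
    have h1 := hqa 0
    have h2 := haM 0
    have h3 := hqR 0
    have h4 := hqR 1
    by_contra hneg
    nlinarith
  refine ⟨1 / (4 * (M + 2)), by positivity [show (0:ℝ) < M + 2 by linarith], ?_⟩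
  intro Q P hQ
  have hex : ∃ n, 2 * Q < q (n + 1) := ⟨(2 * Q).toNat, by
    have := hqn ((2 * Q).toNat + 1)
    push_cast at this
    omega⟩
  classical
  set n := Nat.find hex with hn
  have hn1 : 2 * Q < q (n + 1) := Nat.find_spec hex
  have hn2 : q n ≤ 2 * Q := by
    rcases Nat.eq_zero_or_pos n with h0 | h0
    · rw [h0, hq0]; omega
    · have := Nat.find_min hex (m := n - 1) (by omega)
      rw [Nat.sub_add_cancel h0] at this
      omega
  have hQR : (1 : ℝ) ≤ Q := by exact_mod_cast hQ
  have hn1R : 2 * (Q : ℝ) < q (n + 1) := by exact_mod_cast hn1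
  have hn2R : (q n : ℝ) ≤ 2 * Q := by exact_mod_cast hn2
  have hqn1 := hqR n
  rw [div_le_iff₀ (by linarith)]
  by_cases hdet : P * q n - Q * p n = 0
  · have hdetR : (P : ℝ) * q n - Q * p n = 0 := by exact_mod_cast hdet
    have e : (q n : ℝ) * |Q * α - P| = Q * |q n * α - p n| := by
      rw [← abs_of_pos (show (0 : ℝ) < q n by linarith), ← abs_mul,
        abs_of_pos (show (0 : ℝ) < q n by linarith)]
      nth_rewrite 2 [← abs_of_pos (show (0 : ℝ) < Q by linarith)]
      rw [← abs_mul]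
      congr 1
      linear_combination -hdetR
    have h1 := hlow n
    have h2 : q n + q (n + 1) ≤ (M + 2) * q n := by nlinarith [hqa n, haM n]
    have h3 : 1 ≤ (M + 2) * q n * |q n * α - p n| := by
      rw [div_le_iff₀ (by linarith [hqR (n + 1)])] at h1
      nlinarith [abs_nonneg (q n * α - p n)]
    have h4 : (Q : ℝ) ≤ (M + 2) * q n * (q n * |Q * α - P|) := by
      rw [e]; nlinarith
    have h5 : (q n : ℝ) * q n ≤ 4 * Q * Q := by nlinarith
    have h6 : (Q : ℝ) ≤ (M + 2) * (4 * Q * Q) * |Q * α - P| :=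
      h4.trans (by
        have : (M + 2) * q n * (q n * |Q * α - P|) = (M + 2) * (q n * q n) * |Q * α - P| := by ring
        rw [this]
        have : 0 ≤ M + 2 := by linarith
        gcongr)
    have h7 : (Q : ℝ) * 1 ≤ Q * (Q * |Q * α - P| * (4 * (M + 2))) := by linarith
    exact le_of_mul_le_mul_left h7 (by linarith)
  · have h1 : (1 : ℝ) ≤ |(P : ℝ) * q n - Q * p n| := by
      exact_mod_cast Int.one_le_abs hdet
    have h2 : |(P : ℝ) * q n - Q * p n| ≤ Q * |q n * α - p n| + q n * |Q * α - P| := by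
      have e : (P : ℝ) * q n - Q * p n = Q * (q n * α - p n) - q n * (Q * α - P) := by ring
      rw [e]
      refine (abs_sub _ _).trans ?_
      rw [abs_mul, abs_mul, abs_of_pos (show (0 : ℝ) < Q by linarith),
        abs_of_pos (show (0 : ℝ) < q n by linarith)]
    have h3 : Q * |q n * α - p n| ≤ 1 / 2 := by
      have := herr n
      rw [le_div_iff₀ (by linarith)] at this
      nlinarith [abs_nonneg (q n * α - p n)]
    have h4 : q n * |Q * α - P| ≤ 2 * Q * |Q * α - P| := by gcongr
    have h5 : 0 ≤ Q * |Q * α - P| := by positivity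
    nlinarith

/-- When the partial quotients are bounded, the integer multiples of `α` approach the integers
from both sides at the optimal rate. -/
theorem HasBoundedPartialQuotients.exists_small {α : ℝ} (hα : Irrational α)
    (h : HasBoundedPartialQuotients α) :
    ∃ K : ℝ, ∀ ε : ℝ, 0 < ε → ε ≤ 1 →
      (∃ j : ℕ, ∃ p : ℤ, 1 ≤ j ∧ j * ε ≤ K ∧ 0 < j * α - p ∧ j * α - p < ε) ∧
      (∃ j : ℕ, ∃ p : ℤ, 1 ≤ j ∧ j * ε ≤ K ∧ 0 < p - j * α ∧ p - j * α < ε) := by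
  obtain ⟨M, hM⟩ := h
  obtain ⟨p, q, a, ha, hq0, hqn, hq1, hqm, -, hqa, hpos, -, herr⟩ := exists_convergents hα
  have haM : ∀ n, a n ≤ M := fun n => hM ⟨n, ha n⟩
  have hqR : ∀ n, (1 : ℝ) ≤ q n := fun n => by exact_mod_cast hq1 n
  refine ⟨M + 1, fun ε hε hε1 => ?_⟩
  have hex : ∃ n, 1 < q (n + 1) * ε := ⟨⌈1 / ε⌉₊, by
    have h1 : ((⌈1 / ε⌉₊ + 1 : ℕ) : ℝ) ≤ q (⌈1 / ε⌉₊ + 1) := by exact_mod_cast hqn _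
    have h2 := Nat.le_ceil (1 / ε)
    push_cast at h1
    rw [← div_lt_iff₀ hε]
    linarith⟩
  classical
  set n := Nat.find hex with hn
  have hn1 : 1 < q (n + 1) * ε := Nat.find_spec hex
  have hn2 : q n * ε ≤ 1 := by
    rcases Nat.eq_zero_or_pos n with h0 | h0
    · rw [h0, hq0]; simpa using hε1
    · have := Nat.find_min hex (m := n - 1) (by omega)
      rw [Nat.sub_add_cancel h0] at this
      linarith
  have hqmR : ∀ n, (q n : ℝ) ≤ q (n + 1) := fun n => by exact_mod_cast hqm n
  have b1 : q (n + 1) * ε ≤ M + 1 := by nlinarith [hqa n, haM n, hqR n, hqR (n + 1)]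
  have b0 : q n * ε ≤ M + 1 := by nlinarith [hqmR n]
  have e0 : |q n * α - p n| < ε :=
    (herr n).trans_lt ((div_lt_iff₀ (by linarith [hqR (n + 1)])).2 (by linarith))
  have e1 : |q (n + 1) * α - p (n + 1)| < ε :=
    (herr (n + 1)).trans_lt ((div_lt_iff₀ (by linarith [hqR (n + 2)])).2
      (by nlinarith [hqmR (n + 1)]))
  have c : ∀ m, (((q m).toNat : ℕ) : ℝ) = q m := fun m => by
    have : (((q m).toNat : ℕ) : ℤ) = q m := Int.toNat_of_nonneg (by linarith [hq1 m])
    exact_mod_cast this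
  have c1 : ∀ m, 1 ≤ (q m).toNat := fun m => by have := hq1 m; omega
  rcases Nat.even_or_odd n with he | ho
  · have s0 := hpos n
    have s1 := hpos (n + 1)
    rw [he.neg_one_pow] at s0
    rw [he.add_one.neg_one_pow] at s1
    refine ⟨⟨(q n).toNat, p n, c1 n, ?_, ?_, ?_⟩, ⟨(q (n + 1)).toNat, p (n + 1), c1 _, ?_, ?_, ?_⟩⟩
      <;> rw [c] <;> linarith [abs_lt.1 e0, abs_lt.1 e1]
  · have s0 := hpos n
    have s1 := hpos (n + 1)
    rw [ho.neg_one_pow] at s0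
    rw [ho.add_one.neg_one_pow] at s1
    refine ⟨⟨(q (n + 1)).toNat, p (n + 1), c1 _, ?_, ?_, ?_⟩, ⟨(q n).toNat, p n, c1 n, ?_, ?_, ?_⟩⟩
      <;> rw [c] <;> linarith [abs_lt.1 e0, abs_lt.1 e1]

/-- The negative multiples of an irrational number are dense modulo one. -/
theorem exists_neg_mul_mem_Ioo {α : ℝ} (hα : Irrational α) (x : ℝ) {η : ℝ} (hη : 0 < η) (N : ℕ) :
    ∃ m : ℕ, ∃ z : ℤ, N ≤ m ∧ x < z - m * α ∧ z - m * α < x + η := by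
  obtain ⟨p, q, a, -, -, hqn, hq1, -, -, -, hpos, -, herr⟩ := exists_convergents hα
  obtain ⟨j, P, hj, hs0, hs1⟩ : ∃ j : ℕ, ∃ P : ℤ, 1 ≤ j ∧ 0 < P - j * α ∧ P - j * α < η := by
    set n := 2 * ⌈1 / η⌉₊ + 1 with hn
    have h1 := hpos n
    rw [(odd_two_mul_add_one _).neg_one_pow] at h1
    have h2 : ((n + 1 : ℕ) : ℝ) ≤ q (n + 1) := by exact_mod_cast hqn _
    have h3 := Nat.le_ceil (1 / η)
    have c : (((q n).toNat : ℕ) : ℝ) = q n := by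
      have : (((q n).toNat : ℕ) : ℤ) = q n := Int.toNat_of_nonneg (by linarith [hq1 n])
      exact_mod_cast this
    refine ⟨(q n).toNat, p n, by have := hq1 n; omega, by rw [c]; linarith, ?_⟩
    have h4 := (herr n)
    rw [abs_of_neg (by linarith)] at h4
    have h5 : 1 / (q (n + 1) : ℝ) < η := by
      have h6 : 1 / η < q (n + 1) := by
        have : (n : ℝ) = 2 * ⌈1 / η⌉₊ + 1 := by rw [hn]; push_cast; ring
        push_cast at h2
        have := Nat.cast_nonneg (α := ℝ) ⌈1 / η⌉₊
        linarith
      exact (one_div_lt hη (by linarith [one_div_pos.2 hη])).1 h6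
    rw [c]
    linarith
  set s : ℝ := P - j * α with hs
  obtain ⟨Z, hZ⟩ : ∃ Z : ℤ, (Z : ℝ) ≤ x - N * s := ⟨_, Int.floor_le _⟩
  set k : ℤ := ⌊(x - Z) / s⌋ + 1 with hk
  have hk1 : (x - Z) / s < k := by rw [hk]; push_cast; exact Int.lt_floor_add_one _
  have hk2 : (k : ℝ) ≤ (x - Z) / s + 1 := by
    rw [hk]; push_cast; linarith [Int.floor_le ((x - Z) / s)]
  rw [div_lt_iff₀ hs0] at hk1
  have hk3 : (k - 1) * s ≤ x - Z := by rw [← le_div_iff₀ hs0]; linarith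
  have hkN : (N : ℝ) < k := by
    by_contra hcon
    nlinarith
  have hkN' : (N : ℤ) < k := by exact_mod_cast hkN
  have ck : ((k.toNat : ℕ) : ℝ) = k := by
    have : ((k.toNat : ℕ) : ℤ) = k := Int.toNat_of_nonneg (by omega)
    exact_mod_cast this
  refine ⟨k.toNat * j, k * P + Z, ?_, ?_, ?_⟩
  · have : N ≤ k.toNat := by omega
    nlinarith
  · push_cast
    rw [ck]
    have : (k : ℝ) * P + Z - k * j * α = Z + k * s := by rw [hs]; ring
    linarith
  · push_cast
    rw [ck]
    have : (k : ℝ) * P + Z - k * j * α = Z + k * s := by rw [hs]; ring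
    linarith

/-- The word of length `n` read off along the rotation orbit of `x`. -/
noncomputable def orbitWord (α x : ℝ) (n : ℕ) : List (Fin 2) :=
  (List.range n).map (rotationWord α x)

@[simp]
theorem length_orbitWord (α x : ℝ) (n : ℕ) : (orbitWord α x n).length = n := by
  simp [orbitWord]

theorem orbitWord_succ (α x : ℝ) (n : ℕ) :
    orbitWord α x (n + 1) = orbitWord α x n ++ [rotationWord α x n] := by
  simp [orbitWord, List.range_succ]

theorem rotationWord_add_mul (α x : ℝ) (i n : ℕ) :
    rotationWord α (x + i * α) n = rotationWord α x (i + n) := by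
  rw [← shift_rotationWord, shift_apply]

theorem rotationWord_add_int (α x : ℝ) (z : ℤ) : rotationWord α (x + z) = rotationWord α x := by
  funext n
  simp only [rotationWord, ← add_assoc, Int.fract_add_intCast]

theorem orbitWord_eq_iff {α x y : ℝ} {n : ℕ} :
    orbitWord α x n = orbitWord α y n ↔ ∀ k < n, rotationWord α x k = rotationWord α y k := by
  simp [orbitWord]

theorem orbitWord_add_int (α x : ℝ) (z : ℤ) (n : ℕ) :
    orbitWord α (x + z) n = orbitWord α x n := by
  rw [orbitWord, rotationWord_add_int, orbitWord]

theorem take_orbitWord (α x : ℝ) {m n : ℕ} (h : m ≤ n) :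
    (orbitWord α x n).take m = orbitWord α x m := by
  rw [orbitWord, ← List.map_take, List.take_range, min_eq_left h, orbitWord]

theorem drop_orbitWord (α x : ℝ) (i n : ℕ) :
    (orbitWord α x n).drop i = orbitWord α (x + i * α) (n - i) := by
  refine List.ext_getElem (by simp) fun k h₁ h₂ => ?_
  simp only [orbitWord, List.getElem_drop, List.getElem_map, List.getElem_range,
    rotationWord_add_mul]

theorem prefix_orbitWord_iff {α x : ℝ} {n : ℕ} {u : List (Fin 2)} :
    u <+: orbitWord α x n ↔ u.length ≤ n ∧ u = orbitWord α x u.length := by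
  constructor
  · intro h
    have hl : u.length ≤ n := by simpa using h.length_le
    refine ⟨hl, ?_⟩
    rw [← take_orbitWord α x hl]
    exact List.prefix_iff_eq_take.1 h
  · rintro ⟨hl, h⟩
    rw [h, ← take_orbitWord α x hl]
    exact List.take_prefix _ _

theorem occursAt_rotationWord_iff {α x : ℝ} {w : List (Fin 2)} {i : ℕ} :
    OccursAt (rotationWord α x) w i ↔ orbitWord α (x + i * α) w.length = w := by
  constructor
  · intro h
    refine List.ext_getElem (by simp) fun k h₁ h₂ => ?_
    simpa [orbitWord, rotationWord_add_mul] using h ⟨k, h₂⟩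
  · intro h k
    rw [List.get_eq_getElem]
    conv_rhs => rw [← List.getElem_of_eq h (by simp)]
    simp [orbitWord, rotationWord_add_mul]

theorem exists_eq_rotationWord_of_mem {α : ℝ} {ξ : ℕ → Fin 2}
    (h : ξ ∈ (sturmianSubshift α).carrier) (N : ℕ) :
    ∃ x, ∀ k < N, ξ k = rotationWord α x k := by
  have hopen : IsOpen (⋂ k ∈ Finset.range N, {η : ℕ → Fin 2 | ξ k = η k}) := by
    refine isOpen_biInter_finset fun k _ => ?_
    exact (isOpen_discrete {a : Fin 2 | ξ k = a}).preimage (continuous_apply k)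
  obtain ⟨_, hη, x, rfl⟩ := mem_closure_iff.1 h _ hopen (by simp)
  exact ⟨x, by simpa using hη⟩

theorem orbitWord_mem_language (α x : ℝ) (n : ℕ) :
    orbitWord α x n ∈ language (sturmianSubshift α) :=
  ⟨rotationWord α x, subset_closure ⟨x, rfl⟩, 0, occursAt_rotationWord_iff.2 (by simp)⟩

theorem occursAt_iff_orbitWord_eq {α : ℝ} {ξ : ℕ → Fin 2} {w : List (Fin 2)} {i : ℕ} {x : ℝ}
    {N : ℕ} (hx : ∀ k < N, ξ k = rotationWord α x k) (hN : i + w.length ≤ N) :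
    OccursAt ξ w i ↔ orbitWord α (x + i * α) w.length = w := by
  rw [← occursAt_rotationWord_iff]
  have : ∀ k : Fin w.length, ξ (i + k) = rotationWord α x (i + k) := fun k => hx _ (by omega)
  simp only [OccursAt, this]

theorem mem_language_iff {α : ℝ} {w : List (Fin 2)} :
    w ∈ language (sturmianSubshift α) ↔ ∃ x, w = orbitWord α x w.length := by
  constructor
  · rintro ⟨ξ, hξ, i, h⟩
    obtain ⟨x, hx⟩ := exists_eq_rotationWord_of_mem hξ (i + w.length)
    exact ⟨x + i * α, ((occursAt_iff_orbitWord_eq hx le_rfl).1 h).symm⟩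
  · rintro ⟨x, h⟩
    rw [h]
    exact orbitWord_mem_language _ _ _

/-- The orbits of `x` and `y` in `ℝ` under the translation by `α` pass the same integers during
the first `n` steps. -/
def FloorsAgree (α : ℝ) (n : ℕ) (x y : ℝ) : Prop :=
  ∀ k ≤ n, ⌊x + k * α⌋ = ⌊y + k * α⌋

theorem FloorsAgree.mono {α : ℝ} {m n : ℕ} {x y : ℝ} (h : FloorsAgree α n x y) (hmn : m ≤ n) :
    FloorsAgree α m x y :=
  fun k hk => h k (hk.trans hmn)

theorem FloorsAgree.symm {α : ℝ} {n : ℕ} {x y : ℝ} (h : FloorsAgree α n x y) :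
    FloorsAgree α n y x :=
  fun k hk => (h k hk).symm

theorem FloorsAgree.trans {α : ℝ} {n : ℕ} {x y z : ℝ} (h : FloorsAgree α n x y)
    (h' : FloorsAgree α n y z) : FloorsAgree α n x z :=
  fun k hk => (h k hk).trans (h' k hk)

/-- If the floors of the orbits of `x ≤ y` do not agree, an integer separates the two orbits. -/
theorem exists_int_of_not_floorsAgree {α : ℝ} {n : ℕ} {x y : ℝ} (hxy : x ≤ y)
    (h : ¬ FloorsAgree α n x y) :
    ∃ k ≤ n, ∃ z : ℤ, x + k * α < z ∧ z ≤ y + k * α := by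
  simp only [FloorsAgree, not_forall] at h
  obtain ⟨k, hk, hne⟩ := h
  have hlt : ⌊x + k * α⌋ < ⌊y + k * α⌋ :=
    lt_of_le_of_ne (Int.floor_le_floor (by linarith)) hne
  exact ⟨k, hk, ⌊y + k * α⌋, Int.floor_lt.1 hlt, Int.floor_le _⟩

theorem rotationWord_eq_zero_or_one {α : ℝ} (hα0 : 0 < α) (hα1 : α < 1)
    (x : ℝ) (n : ℕ) :
    (rotationWord α x n = 0 ∧ ⌊x + (n + 1 : ℕ) * α⌋ = ⌊x + n * α⌋) ∨
      (rotationWord α x n = 1 ∧ ⌊x + (n + 1 : ℕ) * α⌋ = ⌊x + n * α⌋ + 1) := by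
  have e : (n : ℝ) * α + x = x + n * α := add_comm _ _
  have h1 := Int.floor_add_fract (x + n * α)
  have h2 := Int.fract_nonneg (x + n * α)
  have h3 := Int.fract_lt_one (x + n * α)
  by_cases h : Int.fract (x + n * α) < 1 - α
  · left
    refine ⟨by simp [rotationWord, e, h], ?_⟩
    rw [Int.floor_eq_iff]
    push_cast
    constructor <;> linarith
  · right
    refine ⟨by simp [rotationWord, e, h], ?_⟩
    rw [Int.floor_eq_iff]
    push_cast
    constructor <;> linarith

theorem FloorsAgree.orbitWord_eq {α : ℝ} (hα0 : 0 < α) (hα1 : α < 1)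
    {n : ℕ} {x y : ℝ} (h : FloorsAgree α n x y) :
    orbitWord α x n = orbitWord α y n := by
  rw [orbitWord_eq_iff]
  intro k hk
  have e1 := h k hk.le
  have e2 := h (k + 1) hk
  rcases rotationWord_eq_zero_or_one hα0 hα1 x k with ⟨a1, a2⟩ | ⟨a1, a2⟩ <;>
  rcases rotationWord_eq_zero_or_one hα0 hα1 y k with ⟨b1, b2⟩ | ⟨b1, b2⟩ <;>
  first | (rw [a1, b1]; done) | omega

theorem floorsAgree_of_orbitWord_eq {α : ℝ} (hα0 : 0 < α) (hα1 : α < 1) {n : ℕ} {x y : ℝ}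
    (h0 : ⌊x⌋ = ⌊y⌋)
    (h : orbitWord α x n = orbitWord α y n) : FloorsAgree α n x y := by
  rw [orbitWord_eq_iff] at h
  intro k
  induction k with
  | zero => intro _; simpa using h0
  | succ k ih =>
    intro hk
    have e1 := ih (by omega)
    have e2 := h k (by omega)
    rcases rotationWord_eq_zero_or_one hα0 hα1 x k with ⟨a1, a2⟩ | ⟨a1, a2⟩ <;>
    rcases rotationWord_eq_zero_or_one hα0 hα1 y k with ⟨b1, b2⟩ | ⟨b1, b2⟩ <;>
    first | (rw [a2, b2, e1]; done) | (rw [a1, b1] at e2; exact absurd e2 (by decide))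

theorem orbitWord_eq_iff_exists_floorsAgree {α : ℝ} (hα0 : 0 < α) (hα1 : α < 1)
    {n : ℕ} {x y : ℝ} :
    orbitWord α x n = orbitWord α y n ↔ ∃ z : ℤ, FloorsAgree α n (x + z) y := by
  constructor
  · intro h
    refine ⟨⌊y⌋ - ⌊x⌋, floorsAgree_of_orbitWord_eq hα0 hα1 ?_ ?_⟩
    · rw [Int.floor_add_intCast]; ring
    · rw [orbitWord_add_int, h]
  · rintro ⟨z, h⟩
    rw [← h.orbitWord_eq hα0 hα1, orbitWord_add_int]

theorem exists_pos_forall_le (f : ℕ → ℝ) (n : ℕ) (h : ∀ k ≤ n, 0 < f k) :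
    ∃ η, 0 < η ∧ ∀ k ≤ n, η ≤ f k := by
  obtain ⟨k, hk, hmin⟩ := Finset.exists_min_image (Finset.range (n + 1)) f ⟨0, by simp⟩
  exact ⟨f k, h k (by simpa [Nat.lt_succ_iff] using hk),
    fun i hi => hmin i (by simpa [Nat.lt_succ_iff] using hi)⟩

theorem exists_recurrence {α : ℝ} (hα : Irrational α) (hα0 : 0 < α) (hα1 : α < 1)
    (h : HasBoundedPartialQuotients α) :
    ∃ C : ℝ, ∀ n : ℕ, 1 ≤ n → ∀ y, ∃ j : ℕ, 1 ≤ j ∧ (j : ℝ) ≤ C * n ∧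
      orbitWord α (y + j * α) n = orbitWord α y n := by
  obtain ⟨K, hK⟩ := h.exists_small hα
  obtain ⟨c, hc, hc1, hba⟩ : ∃ c : ℝ, 0 < c ∧ c ≤ 1 ∧ ∀ q p : ℤ, 1 ≤ q → c ≤ q * |q * α - p| := by
    obtain ⟨c, hc, hba⟩ := h.isBadlyApproximable hα
    exact ⟨min c 1, by positivity, min_le_right _ _,
      fun q p hq => (min_le_left _ _).trans (hba q p hq)⟩
  refine ⟨K * (2 / c), fun n hn y => ?_⟩
  have hnR : (1 : ℝ) ≤ n := by exact_mod_cast hn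
  have hε : 0 < c / (2 * n) := by positivity
  have hε1 : c / (2 * n) ≤ 1 / 2 := by
    rw [div_le_div_iff₀ (by positivity) (by norm_num)]
    linarith
  obtain ⟨⟨j, p, hj, hjK, hs0, hs1⟩, ⟨j', p', hj', hjK', hs0', hs1'⟩⟩ :=
    hK _ hε (by linarith)
  have bound : ∀ i : ℕ, (i : ℝ) * (c / (2 * n)) ≤ K → (i : ℝ) ≤ K * (2 / c) * n := by
    intro i hi
    calc (i : ℝ) = i * (c / (2 * n)) * (2 / c * n) := by field_simp
      _ ≤ K * (2 / c * n) := by gcongr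
      _ = _ := by ring
  by_cases h1 : FloorsAgree α n y (y + (j * α - p))
  · refine ⟨j, hj, bound j hjK, ?_⟩
    rw [h1.orbitWord_eq hα0 hα1, ← orbitWord_add_int α (y + (j * α - p)) p]
    ring_nf
  by_cases h2 : FloorsAgree α n (y - (p' - j' * α)) y
  · refine ⟨j', hj', bound j' hjK', ?_⟩
    rw [← h2.orbitWord_eq hα0 hα1, ← orbitWord_add_int α (y - (p' - j' * α)) p']
    ring_nf
  exfalso
  obtain ⟨k, hk, z, hz1, hz2⟩ := exists_int_of_not_floorsAgree (by linarith) h1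
  obtain ⟨k', hk', z', hz1', hz2'⟩ := exists_int_of_not_floorsAgree (by linarith) h2
  have hD0 : 0 < ((z : ℝ) - z') - (k - k') * α := by linarith
  have hD1 : ((z : ℝ) - z') - (k - k') * α < c / n := by
    have : c / n = 2 * (c / (2 * n)) := by field_simp
    linarith
  have hcn : c / n ≤ 1 := (div_le_one (by linarith)).2 (by linarith)
  have hkR : (k : ℝ) ≤ n := by exact_mod_cast hk
  have hkR' : (k' : ℝ) ≤ n := by exact_mod_cast hk'
  have hk0 : (0 : ℝ) ≤ k := Nat.cast_nonneg k
  have hk0' : (0 : ℝ) ≤ k' := Nat.cast_nonneg k'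
  rw [lt_div_iff₀ (by linarith)] at hD1
  rcases lt_trichotomy k k' with hlt | heq | hlt
  · have h3 := hba ((k' : ℤ) - k) (z' - z) (by omega)
    push_cast at h3
    have e : ((k' : ℝ) - k) * α - (z' - z) = ((z : ℝ) - z') - (k - k') * α := by ring
    rw [e, abs_of_pos hD0] at h3
    nlinarith
  · subst heq
    rw [← lt_div_iff₀ (by linarith)] at hD1
    have h3 : (0 : ℝ) < ((z - z' : ℤ) : ℝ) := by push_cast; linarith
    have h4 : ((z - z' : ℤ) : ℝ) < 1 := by push_cast; linarith
    have h5 : 0 < z - z' := by exact_mod_cast h3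
    have h6 : z - z' < 1 := by exact_mod_cast h4
    omega
  · have h3 := hba ((k : ℤ) - k') (z - z') (by omega)
    push_cast at h3
    have e : ((k : ℝ) - k') * α - (z - z') = -(((z : ℝ) - z') - (k - k') * α) := by ring
    rw [e, abs_neg, abs_of_pos hD0] at h3
    nlinarith

theorem HasBoundedPartialQuotients.isLinearlyRecurrent {α : ℝ} (hα : Irrational α) (hα0 : 0 < α)
    (hα1 : α < 1) (h : HasBoundedPartialQuotients α) :
    IsLinearlyRecurrent (sturmianSubshift α) := by
  obtain ⟨C, hC⟩ := exists_recurrence hα hα0 hα1 h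
  refine ⟨C, fun u _ hu0 ξ hξ i hi => ?_⟩
  obtain ⟨x, hx⟩ := exists_eq_rotationWord_of_mem hξ (i + ⌊C * u.length⌋₊ + u.length)
  rw [occursAt_iff_orbitWord_eq hx (by omega)] at hi
  obtain ⟨j, hj1, hjC, hj⟩ := hC u.length (List.length_pos_iff.2 hu0) (x + i * α)
  have hjf : j ≤ ⌊C * u.length⌋₊ := Nat.le_floor hjC
  refine ⟨i + j, by omega, ?_, by push_cast; linarith⟩
  rw [occursAt_iff_orbitWord_eq hx (by omega), ← hi, length_orbitWord, ← hj]
  congr 1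
  push_cast
  ring

theorem isRightSpecial_orbitWord {α : ℝ} (hα : Irrational α) (hα0 : 0 < α) (hα1 : α < 1) (m : ℕ) :
    IsRightSpecial (sturmianSubshift α) (orbitWord α (-((m + 1 : ℕ) * α)) m) := by
  set x : ℝ := -((m + 1 : ℕ) * α) with hx
  have hpos : ∀ k ≤ m, 0 < Int.fract (x + k * α) := by
    intro k hk
    refine lt_of_le_of_ne (Int.fract_nonneg _) fun h0 => ?_
    have h1 := Int.floor_add_fract (x + k * α)
    rw [← h0, add_zero] at h1
    have h2 : x + k * α = ((-((m + 1 - k : ℕ) : ℤ) : ℤ) : ℝ) * α := by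
      rw [hx]; push_cast [Nat.cast_sub (show k ≤ m + 1 by omega)]; ring
    rw [h2] at h1
    exact (hα.intCast_mul (by omega : (-((m + 1 - k : ℕ) : ℤ)) ≠ 0)).ne_int _ h1.symm
  obtain ⟨η, hη, hle⟩ := exists_pos_forall_le _ m hpos
  have hag : FloorsAgree α m (x - η) x := by
    intro k hk
    have h1 := hle k hk
    have h2 := Int.floor_add_fract (x + k * α)
    have h3 := Int.fract_lt_one (x + k * α)
    rw [Int.floor_eq_iff]
    constructor <;> linarith
  have hη1 : η < 1 := (hle 0 (by omega)).trans_lt (Int.fract_lt_one _)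
  have hxm : ⌊x + m * α⌋ = -1 := by
    rw [Int.floor_eq_iff, hx]; push_cast; constructor <;> linarith
  have hx1 : ⌊x + (m + 1 : ℕ) * α⌋ = 0 := by rw [hx]; simp
  have hx2 : ⌊x - η + (m + 1 : ℕ) * α⌋ = -1 := by
    rw [Int.floor_eq_iff, hx]; push_cast; constructor <;> linarith
  refine ⟨0, 1, by decide, ?_, ?_⟩
  · have hl : rotationWord α (x - η) m = 0 := by
      rcases rotationWord_eq_zero_or_one hα0 hα1 (x - η) m with h | h
      · exact h.1
      · have := h.2
        rw [hx2, hag m le_rfl, hxm] at this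
        omega
    rw [← hl, ← hag.orbitWord_eq hα0 hα1, ← orbitWord_succ]
    exact orbitWord_mem_language _ _ _
  · have hl : rotationWord α x m = 1 := by
      rcases rotationWord_eq_zero_or_one hα0 hα1 x m with h | h
      · have := h.2
        rw [hx1, hxm] at this
        omega
      · exact h.1
    rw [← hl, ← orbitWord_succ]
    exact orbitWord_mem_language _ _ _

/-- Every word of the language is a prefix of some word read off along an orbit that is about to
hit the discontinuity. -/
theorem exists_orbitWord_neg_eq {α : ℝ} (hα : Irrational α) (hα0 : 0 < α) (hα1 : α < 1)
    {u : List (Fin 2)} (hu : u ∈ language (sturmianSubshift α)) :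
    ∃ m, u.length ≤ m ∧ orbitWord α (-((m + 1 : ℕ) * α)) u.length = u := by
  obtain ⟨y, hy⟩ := mem_language_iff.1 hu
  obtain ⟨η, hη, hle⟩ := exists_pos_forall_le (fun k => 1 - Int.fract (y + k * α)) u.length
    fun k _ => sub_pos.2 (Int.fract_lt_one _)
  obtain ⟨m, z, hm, h1, h2⟩ := exists_neg_mul_mem_Ioo hα y hη (u.length + 1)
  refine ⟨m - 1, by omega, ?_⟩
  rw [Nat.sub_add_cancel (by omega)]
  have hag : FloorsAgree α u.length (-(m * α) + z) y := by
    intro k hk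
    have h3 := hle k hk
    have h4 := Int.floor_add_fract (y + k * α)
    have h5 := Int.fract_nonneg (y + k * α)
    rw [Int.floor_eq_iff]
    constructor <;> linarith
  rw [← orbitWord_add_int α _ z, hag.orbitWord_eq hα0 hα1, ← hy]

theorem exists_isShortestRightSpecialExtension {A : Type*} [TopologicalSpace A] {X : Subshift A ℕ}
    {u r : List A} (hr : IsRightSpecial X r) (hu : u <+: r) :
    ∃ s, IsShortestRightSpecialExtension X u s := by
  classical
  have hex : ∃ n, ∃ s, IsRightSpecial X s ∧ u <+: s ∧ s.length = n := ⟨_, r, hr, hu, rfl⟩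
  obtain ⟨s, hs, hus, hl⟩ := Nat.find_spec hex
  exact ⟨s, hs, hus, fun r' hr' hu' => hl ▸ Nat.find_min' hex ⟨r', hr', hu', rfl⟩⟩

theorem phiZero_isShortest {α : ℝ} (hα : Irrational α) (hα0 : 0 < α) (hα1 : α < 1)
    {u : List (Fin 2)} (hu : u ∈ language (sturmianSubshift α)) :
    IsShortestRightSpecialExtension (sturmianSubshift α) u (phiZero (sturmianSubshift α) u) := by
  obtain ⟨m, hm, he⟩ := exists_orbitWord_neg_eq hα hα0 hα1 hu
  obtain ⟨s, hs⟩ := exists_isShortestRightSpecialExtension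
    (isRightSpecial_orbitWord hα hα0 hα1 m) (prefix_orbitWord_iff.2 ⟨hm, he.symm⟩)
  exact phiZero_spec hs

theorem IsLinearlyRecurrent.exists_length_phiZero_le {α : ℝ} (hα : Irrational α) (hα0 : 0 < α)
    (hα1 : α < 1) (h : IsLinearlyRecurrent (sturmianSubshift α)) :
    ∃ C : ℝ, ∀ u ∈ language (sturmianSubshift α), u ≠ [] →
      ((phiZero (sturmianSubshift α) u).length : ℝ) ≤ C * u.length := by
  obtain ⟨C, hC⟩ := h
  refine ⟨C + 1, fun u hu hu0 => ?_⟩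
  classical
  have hex := exists_orbitWord_neg_eq hα hα0 hα1 hu
  set m := Nat.find hex with hmdef
  obtain ⟨hm, he⟩ : u.length ≤ m ∧ orbitWord α (-((m + 1 : ℕ) * α)) u.length = u :=
    Nat.find_spec hex
  have hphi := (phiZero_isShortest hα hα0 hα1 hu).2.2 _
    (isRightSpecial_orbitWord hα hα0 hα1 m) (prefix_orbitWord_iff.2 ⟨hm, he.symm⟩)
  rw [length_orbitWord] at hphi
  have hphiR : ((phiZero (sturmianSubshift α) u).length : ℝ) ≤ m := by exact_mod_cast hphi
  obtain ⟨j, hj0, hj, hjC⟩ := hC u hu hu0 (rotationWord α (-((m + 1 : ℕ) * α)))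
    (subset_closure ⟨_, rfl⟩) 0 (occursAt_rotationWord_iff.2 (by simpa using he))
  rw [occursAt_rotationWord_iff] at hj
  have hlt : m < u.length + j := by
    by_contra hcon
    refine Nat.find_min hex (m := m - j) (by omega) ⟨by omega, ?_⟩
    refine Eq.trans ?_ hj
    congr 1
    push_cast [Nat.cast_sub (show j ≤ m by omega)]
    ring
  have hltR : (m : ℝ) < u.length + j := by exact_mod_cast hlt
  push_cast at hjC
  linarith

theorem isCompleteFirstReturn_orbitWord {α y : ℝ} {n j : ℕ} (hn : 1 ≤ n) (hj : 1 ≤ j)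
    (hret : orbitWord α (y + j * α) n = orbitWord α y n)
    (hmin : ∀ i, 1 ≤ i → i < j → orbitWord α (y + i * α) n ≠ orbitWord α y n) :
    IsCompleteFirstReturn (sturmianSubshift α) (orbitWord α y n) (orbitWord α y (n + j)) := by
  refine ⟨orbitWord_mem_language _ _ _, Or.inr ⟨?_, ?_, ?_, ?_⟩⟩
  · intro h
    have := congrArg List.length h
    simp at this
    omega
  · exact prefix_orbitWord_iff.2 ⟨by simp, by simp⟩
  · have h := List.drop_suffix j (orbitWord α y (n + j))
    rwa [drop_orbitWord, Nat.add_sub_cancel, hret] at h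
  · have : occurrences (orbitWord α y n) (orbitWord α y (n + j)) = {0, j} := by
      ext i
      simp only [occurrences, Set.mem_ofPred_eq, Set.mem_insert_iff, Set.mem_singleton_iff,
        length_orbitWord, drop_orbitWord, prefix_orbitWord_iff]
      constructor
      · rintro ⟨h1, -, h2⟩
        by_contra! hcon
        exact hmin i (by omega) (by omega) h2.symm
      · rintro (rfl | rfl)
        · simp
        · exact ⟨by omega, by omega, hret.symm⟩
    rw [this, Set.ncard_pair (by omega)]

/-- If the short prefixes of the orbit of `y` all recur within `q` steps, one of the privileged
prefixes has a length between `q` and `2 q`. -/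
theorem exists_isPrivileged_orbitWord {α y : ℝ} {q : ℕ} (hq : 1 ≤ q)
    (h : ∀ n, 1 ≤ n → n < q → ∃ j, 1 ≤ j ∧ j ≤ q ∧
      orbitWord α (y + (j : ℕ) * α) n = orbitWord α y n) :
    ∃ m, q ≤ m ∧ m ≤ 2 * q ∧ IsPrivileged (sturmianSubshift α) (orbitWord α y m) := by
  classical
  have step : ∀ n < q, IsPrivileged (sturmianSubshift α) (orbitWord α y n) →
      ∃ m, n < m ∧ m ≤ n + q ∧ IsPrivileged (sturmianSubshift α) (orbitWord α y m) := by
    intro n hn hp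
    rcases Nat.eq_zero_or_pos n with rfl | hn0
    · exact ⟨1, by omega, by omega, .ret .nil ⟨orbitWord_mem_language _ _ _, Or.inl ⟨rfl, by simp⟩⟩⟩
    · obtain ⟨j, hj1, hjq, hj⟩ := h n hn0 hn
      have hex : ∃ j : ℕ, 1 ≤ j ∧ orbitWord α (y + j * α) n = orbitWord α y n := ⟨j, hj1, hj⟩
      obtain ⟨h1, h2⟩ := Nat.find_spec hex
      have h3 : Nat.find hex ≤ j := Nat.find_min' hex ⟨hj1, hj⟩
      exact ⟨n + Nat.find hex, by omega, by omega, hp.ret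
        (isCompleteFirstReturn_orbitWord hn0 h1 h2 fun i hi hij he => Nat.find_min hex hij ⟨hi, he⟩)⟩
  have reach : ∀ k ≤ q, ∃ m, k ≤ m ∧ m ≤ 2 * q ∧
      IsPrivileged (sturmianSubshift α) (orbitWord α y m) := by
    intro k
    induction k with
    | zero => exact fun _ => ⟨0, le_rfl, by omega, .nil⟩
    | succ k ih =>
      intro hk
      obtain ⟨m, hkm, hmq, hp⟩ := ih (by omega)
      rcases Nat.lt_or_ge k m with hlt | hge
      · exact ⟨m, hlt, hmq, hp⟩
      · obtain ⟨m', h1, h2, hp'⟩ := step m (by omega) hp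
        exact ⟨m', by omega, by omega, hp'⟩
  exact reach q le_rfl

/-- The two extensions of a right-special word of length `L` come from two points separated by a
translate of `-(L + 1) α`. -/
theorem IsRightSpecial.exists_separated {α : ℝ} (hα0 : 0 < α) (hα1 : α < 1) {r : List (Fin 2)}
    (hr : IsRightSpecial (sturmianSubshift α) r) {y : ℝ} {m : ℕ} (hm : orbitWord α y m <+: r) :
    ∃ x₁ x₂ : ℝ, ∃ z : ℤ, FloorsAgree α m x₁ y ∧ FloorsAgree α m x₂ y ∧
      x₁ < z - (r.length + 1 : ℕ) * α ∧ z - (r.length + 1 : ℕ) * α ≤ x₂ := by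
  obtain ⟨a, b, hab, ha, hb⟩ := hr
  have hmr : m ≤ r.length := by simpa using hm.length_le
  have key : ∀ c, r ++ [c] ∈ language (sturmianSubshift α) → ∃ x, FloorsAgree α m x y ∧
      orbitWord α x r.length = r ∧ rotationWord α x r.length = c := by
    intro c hc
    obtain ⟨x, hx⟩ := mem_language_iff.1 hc
    rw [List.length_append, List.length_singleton, orbitWord_succ] at hx
    obtain ⟨h1, h2⟩ := List.append_inj hx (by simp)
    have h3 : orbitWord α x m = orbitWord α y m := by
      rw [h1] at hm
      simpa using (prefix_orbitWord_iff.1 hm).2.symm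
    obtain ⟨z, hz⟩ := (orbitWord_eq_iff_exists_floorsAgree hα0 hα1).1 h3
    refine ⟨x + z, hz, ?_, ?_⟩
    · rw [orbitWord_add_int, ← h1]
    · rw [rotationWord_add_int]
      exact (List.singleton_inj.1 h2).symm
  obtain ⟨xa, hxa, hra, hla⟩ := key a ha
  obtain ⟨xb, hxb, hrb, hlb⟩ := key b hb
  have sep : ∀ x₁ x₂, x₁ ≤ x₂ → FloorsAgree α m x₁ y → FloorsAgree α m x₂ y →
      orbitWord α x₁ r.length = r → orbitWord α x₂ r.length = r →
      rotationWord α x₁ r.length ≠ rotationWord α x₂ r.length →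
      ∃ x₁ x₂ : ℝ, ∃ z : ℤ, FloorsAgree α m x₁ y ∧ FloorsAgree α m x₂ y ∧
        x₁ < z - (r.length + 1 : ℕ) * α ∧ z - (r.length + 1 : ℕ) * α ≤ x₂ := by
    intro x₁ x₂ hle h₁ h₂ hr₁ hr₂ hne
    have hag : FloorsAgree α r.length x₁ x₂ := by
      refine floorsAgree_of_orbitWord_eq hα0 hα1 ?_ (hr₁.trans hr₂.symm)
      have := (h₁.trans h₂.symm) 0 (Nat.zero_le _)
      simpa using this
    have hnag : ¬ FloorsAgree α (r.length + 1) x₁ x₂ := fun h =>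
      hne (orbitWord_eq_iff.1 (h.orbitWord_eq hα0 hα1) _ (Nat.lt_succ_self _))
    obtain ⟨k, hk, z, hz1, hz2⟩ := exists_int_of_not_floorsAgree hle hnag
    obtain rfl : k = r.length + 1 := by
      by_contra hkne
      have h1 := hag k (by omega)
      have h2 := Int.floor_lt.2 hz1
      have h3 := Int.le_floor.2 hz2
      omega
    exact ⟨x₁, x₂, z, h₁, h₂, by linarith, by linarith⟩
  have hne : rotationWord α xa r.length ≠ rotationWord α xb r.length := by rwa [hla, hlb]
  rcases le_total xa xb with hle | hle
  · exact sep xa xb hle hxa hxb hra hrb hne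
  · exact sep xb xa hle hxb hxa hrb hra hne.symm

theorem exists_mul_sub_mul_eq {p : ℤ} {q : ℕ} (hq : 1 ≤ q) (hpq : IsCoprime p (q : ℤ)) (σ : ℤ) :
    ∃ (j : ℕ) (i : ℤ), 1 ≤ j ∧ j ≤ q ∧ (j : ℤ) * p - q * i = σ := by
  obtain ⟨a, b, hab⟩ := hpq
  have h0 : (0 : ℤ) ≤ (σ * a - 1) % q := Int.emod_nonneg _ (by omega)
  have h1 : (σ * a - 1) % q < q := Int.emod_lt_of_pos _ (by omega)
  have h2 := Int.emod_add_mul_ediv (σ * a - 1) q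
  refine ⟨((σ * a - 1) % q + 1).toNat, -((σ * a - 1) / q * p + σ * b), by omega, by omega, ?_⟩
  rw [Int.toNat_of_nonneg (by omega)]
  linear_combination p * h2 + σ * hab

theorem eq_zero_of_mul_eq_mul {p : ℤ} {q k : ℕ} (hpq : IsCoprime p (q : ℤ)) (hk : k < q) {z : ℤ}
    (h : z * q = k * p) : k = 0 := by
  have h1 : (q : ℤ) ∣ k := hpq.symm.dvd_of_dvd_mul_right ⟨z, by linarith⟩
  have h2 : q ∣ k := by exact_mod_cast h1
  exact Nat.eq_zero_of_dvd_of_lt h2 hk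

/-- If `p / q` is a very good approximation of `α`, there is a point whose short words recur within
`q` steps, while its words of length `q` determine it up to the approximation error. -/
theorem exists_recurrent_point {α : ℝ} (hα : Irrational α) (hα0 : 0 < α) (hα1 : α < 1) {p : ℤ}
    {q : ℕ} (hq : 1 ≤ q) (hpq : IsCoprime p (q : ℤ)) (hsmall : q * |q * α - p| < 1) :
    ∃ y, (∀ n < q, ∃ j, 1 ≤ j ∧ j ≤ q ∧ orbitWord α (y + (j : ℕ) * α) n = orbitWord α y n) ∧
      ∀ x₁ x₂ P, FloorsAgree α q x₁ y → FloorsAgree α q x₂ y → x₁ < P → P ≤ x₂ →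
        |P| < |q * α - p| := by
  have hqR : (1 : ℝ) ≤ q := by exact_mod_cast hq
  have hq0 : (q : ℝ) ≠ 0 := by linarith
  have hne : (q : ℝ) * α - p ≠ 0 := by
    intro h0
    refine (hα.natCast_mul (by omega : q ≠ 0)).ne_int p ?_
    linarith
  rcases lt_or_gt_of_ne hne with hneg | hpos
  · rw [abs_of_neg hneg] at hsmall ⊢
    set ε : ℝ := -(q * α - p) with hε
    have hε0 : 0 < ε := by linarith
    have hε1 : ε < 1 := by nlinarith
    have hqα : q * α = p - ε := by rw [hε]; ring
    refine ⟨0, fun n hn => ?_, fun x₁ x₂ P h₁ h₂ hP₁ hP₂ => ?_⟩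
    · obtain ⟨j, i, hj1, hjq, hji⟩ := exists_mul_sub_mul_eq hq hpq 1
      have hjiR : (j : ℝ) * p - q * i = 1 := by exact_mod_cast hji
      have hjR : (1 : ℝ) ≤ j := by exact_mod_cast hj1
      have hjqR : (j : ℝ) ≤ q := by exact_mod_cast hjq
      have hs : q * (j * α - i) = 1 - j * ε := by linear_combination j * hqα + hjiR
      have hs0 : (0 : ℝ) ≤ j * α - i := by
        by_contra hcon
        nlinarith
      refine ⟨j, hj1, hjq, ?_⟩
      have hag : FloorsAgree α n 0 (j * α - i) := by
        by_contra hcon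
        obtain ⟨k, hk, z, hz1, hz2⟩ := exists_int_of_not_floorsAgree hs0 hcon
        have hkR : (k : ℝ) < q := by exact_mod_cast hk.trans_lt hn
        have hk0 : (0 : ℝ) ≤ k := Nat.cast_nonneg k
        have e1 : k * p - k * ε < z * q := by nlinarith
        have e2 : z * q ≤ 1 - j * ε + (k * p - k * ε) := by nlinarith
        have t1 : (-1 : ℝ) < ((z * q - k * p : ℤ) : ℝ) := by push_cast; nlinarith
        have t2 : ((z * q - k * p : ℤ) : ℝ) < 1 := by push_cast; nlinarith
        have t1' : -1 < z * q - k * p := by exact_mod_cast t1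
        have t2' : z * q - k * p < 1 := by exact_mod_cast t2
        obtain rfl := eq_zero_of_mul_eq_mul hpq (hk.trans_lt hn) (by omega : z * q = k * p)
        simp only [CharP.cast_eq_zero, zero_mul, add_zero, sub_zero] at hz1 t2'
        have hz : 0 < z := by exact_mod_cast hz1
        nlinarith
      rw [hag.orbitWord_eq hα0 hα1, ← orbitWord_add_int α (j * α - i) i]
      ring_nf
    · have a1 := h₁ 0 (Nat.zero_le _)
      have a2 := h₂ q le_rfl
      have b1 : (0 : ℝ) ≤ x₁ := by
        simp only [CharP.cast_eq_zero, zero_mul, add_zero, Int.floor_zero] at a1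
        simpa using Int.floor_le_iff.not.1 (by omega : ¬ ⌊x₁⌋ ≤ -1)
      have b2 : ⌊(0 : ℝ) + q * α⌋ = p - 1 := by
        rw [Int.floor_eq_iff, hqα]; push_cast; constructor <;> linarith
      have b3 := Int.lt_floor_add_one (x₂ + q * α)
      rw [a2, b2] at b3
      push_cast at b3
      rw [abs_lt]
      constructor <;> linarith
  · rw [abs_of_pos hpos] at hsmall ⊢
    set ε : ℝ := q * α - p with hε
    have hε1 : ε < 1 := by nlinarith
    have hqα : q * α = p + ε := by rw [hε]; ring
    have hy0 : 0 < ε / q := by positivity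
    have hyε : ε / q ≤ ε := div_le_self hpos.le hqR
    have hyq : q * (ε / q) = ε := by field_simp
    refine ⟨-(ε / q), fun n hn => ?_, fun x₁ x₂ P h₁ h₂ hP₁ hP₂ => ?_⟩
    · obtain ⟨j, i, hj1, hjq, hji⟩ := exists_mul_sub_mul_eq hq hpq (-1)
      have hjiR : (j : ℝ) * p - q * i = -1 := by exact_mod_cast hji
      have hjR : (1 : ℝ) ≤ j := by exact_mod_cast hj1
      have hjqR : (j : ℝ) ≤ q := by exact_mod_cast hjq
      have hs : q * (j * α - i) = -1 + j * ε := by linear_combination j * hqα + hjiR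
      have hs0 : j * α - i ≤ (0 : ℝ) := by
        by_contra hcon
        nlinarith
      refine ⟨j, hj1, hjq, ?_⟩
      have hag : FloorsAgree α n (-(ε / q) + (j * α - i)) (-(ε / q)) := by
        by_contra hcon
        obtain ⟨k, hk, z, hz1, hz2⟩ := exists_int_of_not_floorsAgree (by linarith) hcon
        have hkR : (k : ℝ) < q := by exact_mod_cast hk.trans_lt hn
        have hk0 : (0 : ℝ) ≤ k := Nat.cast_nonneg k
        have e1 : -ε + (-1 + j * ε) + (k * p + k * ε) < z * q := by nlinarith
        have e2 : z * q ≤ -ε + (k * p + k * ε) := by nlinarith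
        have t1 : (-1 : ℝ) < ((z * q - k * p : ℤ) : ℝ) := by push_cast; nlinarith
        have t2 : ((z * q - k * p : ℤ) : ℝ) < 1 := by push_cast; nlinarith
        have t1' : -1 < z * q - k * p := by exact_mod_cast t1
        have t2' : z * q - k * p < 1 := by exact_mod_cast t2
        obtain rfl := eq_zero_of_mul_eq_mul hpq (hk.trans_lt hn) (by omega : z * q = k * p)
        simp only [CharP.cast_eq_zero, zero_mul, add_zero, sub_zero] at e2 t1'
        have hz : z * q < 0 := by
          have : (z : ℝ) * q < 0 := by linarith
          exact_mod_cast this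
        omega
      rw [← hag.orbitWord_eq hα0 hα1, ← orbitWord_add_int α (-(ε / q) + (j * α - i)) i]
      ring_nf
    · have a1 := h₁ q le_rfl
      have a2 := h₂ 0 (Nat.zero_le _)
      have b1 : ⌊-(ε / q)⌋ = -1 := by
        rw [Int.floor_eq_iff]; push_cast; constructor <;> linarith
      have b2 : x₂ < 0 := by
        simp only [CharP.cast_eq_zero, zero_mul, add_zero, b1] at a2
        have := Int.lt_floor_add_one x₂
        rw [a2] at this
        push_cast at this
        linarith
      have b3 : ⌊-(ε / q) + q * α⌋ = p := by
        rw [Int.floor_eq_iff, hqα]; constructor <;> linarith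
      have b4 := Int.floor_le (x₁ + q * α)
      rw [a1, b3] at b4
      rw [abs_lt]
      constructor <;> linarith

theorem isBadlyApproximable_of_length_phiZero_le {α : ℝ} (hα : Irrational α) (hα0 : 0 < α)
    (hα1 : α < 1) {C : ℝ}
    (hC : ∀ u, IsPrivileged (sturmianSubshift α) u → u ≠ [] →
      ((phiZero (sturmianSubshift α) u).length : ℝ) ≤ C * u.length) :
    IsBadlyApproximable α := by
  wlog hC0 : 0 ≤ C generalizing C
  · exact this (C := 0) (fun u hu hu0 => (hC u hu hu0).trans
      (mul_le_mul_of_nonneg_right (by linarith) (Nat.cast_nonneg _))) le_rfl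
  have coprime : ∀ (q : ℕ) (p : ℤ), 1 ≤ q → IsCoprime p (q : ℤ) →
      1 / (2 * C + 2) ≤ q * |q * α - p| := by
    intro q p hq hpq
    by_contra! hlt
    rw [lt_div_iff₀ (by linarith)] at hlt
    have hqR : (1 : ℝ) ≤ q := by exact_mod_cast hq
    have hnn : 0 ≤ q * |q * α - p| := by positivity
    obtain ⟨y, hrec, hsep⟩ := exists_recurrent_point hα hα0 hα1 hq hpq (by nlinarith)
    obtain ⟨m, hqm, hmq, hpriv⟩ := exists_isPrivileged_orbitWord hq fun n _ hn => hrec n hn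
    set r := phiZero (sturmianSubshift α) (orbitWord α y m) with hr
    have hL := hC _ hpriv (List.ne_nil_of_length_pos (by rw [length_orbitWord]; omega))
    rw [length_orbitWord, ← hr] at hL
    obtain ⟨hr1, hr2, -⟩ := phiZero_isShortest hα hα0 hα1 (orbitWord_mem_language α y m)
    rw [← hr] at hr1 hr2
    obtain ⟨x₁, x₂, z, h₁, h₂, hz₁, hz₂⟩ := hr1.exists_separated hα0 hα1 hr2
    have hP := hsep x₁ x₂ _ (h₁.mono hqm) (h₂.mono hqm) hz₁ hz₂
    set j := r.length + 1 with hj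
    have hmqR : (m : ℝ) ≤ 2 * q := by exact_mod_cast hmq
    have hjR : (j : ℝ) ≤ C * (2 * q) + 1 := by
      rw [hj]; push_cast
      have := mul_le_mul_of_nonneg_left hmqR hC0
      linarith
    set ε : ℝ := |q * α - p| with hε
    have hε0 : 0 ≤ ε := abs_nonneg _
    have hdet : |((z * q - p * j : ℤ) : ℝ)| < 1 := by
      have e : ((z * q - p * j : ℤ) : ℝ) = q * (z - j * α) + j * (q * α - p) := by push_cast; ring
      rw [e]
      refine (abs_add_le _ _).trans_lt ?_
      rw [abs_mul, abs_mul, Nat.abs_cast, Nat.abs_cast, ← hε]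
      have h3 : q * |z - j * α| ≤ q * ε := by gcongr
      have h4 : j * ε ≤ (C * (2 * q) + 1) * ε := by gcongr
      nlinarith
    have hdet0 : z * q = p * j := by
      have h5 : |z * q - p * j| < 1 := by exact_mod_cast hdet
      have := Int.abs_lt_one_iff.1 h5
      omega
    obtain ⟨k, hk⟩ : (q : ℤ) ∣ j := hpq.symm.dvd_of_dvd_mul_left ⟨z, by linarith⟩
    have hk1 : 1 ≤ k := by
      by_contra hcon
      have : (1 : ℤ) ≤ j := by omega
      nlinarith
    have hzk : z = p * k := by
      have hq0 : (q : ℤ) ≠ 0 := by omega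
      refine mul_right_cancel₀ hq0 ?_
      rw [hdet0, hk]; ring
    have hkR : (1 : ℝ) ≤ k := by exact_mod_cast hk1
    have hjk : (j : ℝ) = q * k := by exact_mod_cast hk
    have e : (z : ℝ) - j * α = -(k * (q * α - p)) := by rw [hzk, hjk]; push_cast; ring
    rw [e, abs_neg, abs_mul, abs_of_pos (by linarith : (0 : ℝ) < k), ← hε] at hP
    nlinarith
  refine ⟨1 / (2 * C + 2), by positivity, fun q p hq => ?_⟩
  obtain ⟨g, hg⟩ : ∃ g, g = Int.gcd p q := ⟨_, rfl⟩
  have hgpos : 0 < Int.gcd p q := Int.gcd_pos_of_ne_zero_right _ (by omega)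
  obtain ⟨p', q', hcop, hp', hq'⟩ := Int.exists_gcd_one hgpos
  have hq'pos : 1 ≤ q' := by
    by_contra hcon
    have : (1 : ℤ) ≤ Int.gcd p q := by omega
    nlinarith
  have hcop' : IsCoprime p' ((q'.toNat : ℕ) : ℤ) := by
    rw [Int.toNat_of_nonneg (by omega)]
    exact Int.isCoprime_iff_gcd_eq_one.2 hcop
  have h1 := coprime q'.toNat p' (by omega) hcop'
  have cq : ((q'.toNat : ℕ) : ℝ) = q' := by
    exact_mod_cast Int.toNat_of_nonneg (show 0 ≤ q' by omega)
  rw [cq] at h1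
  have hgR : (1 : ℝ) ≤ (Int.gcd p q : ℕ) := by exact_mod_cast hgpos
  have hqR : (q : ℝ) = q' * (Int.gcd p q : ℕ) := by exact_mod_cast hq'
  have hpR : (p : ℝ) = p' * (Int.gcd p q : ℕ) := by exact_mod_cast hp'
  have hq'R : (1 : ℝ) ≤ q' := by exact_mod_cast hq'pos
  rw [← hg] at hgR hqR hpR
  have e : (q : ℝ) * α - p = g * (q' * α - p') := by rw [hqR, hpR]; ring
  refine h1.trans ?_
  rw [e, hqR, abs_mul, abs_of_pos (by linarith : (0 : ℝ) < g)]
  have hnn : 0 ≤ q' * |q' * α - p'| := by positivity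
  nlinarith [mul_self_nonneg ((g : ℝ) - 1)]

theorem IsPrivileged.mem_language {α : ℝ} {u : List (Fin 2)}
    (hu : IsPrivileged (sturmianSubshift α) u) : u ∈ language (sturmianSubshift α) := by
  cases hu with
  | nil => exact orbitWord_mem_language α 0 0
  | ret _ h => exact h.1

/-- A bounded ratio of weights amounts to a linear bound for the lengths. -/
theorem IsWeightFunction.exists_le_mul {δ : ℤ → ℝ} (hδ : IsWeightFunction δ) (M : ℝ) :
    ∃ C : ℕ, ∀ a b : ℕ, 1 ≤ a → δ a / δ b ≤ M → b ≤ C * a := by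
  obtain ⟨c, hc, hmul⟩ := hδ.mul_le
  obtain ⟨C, hC1, hC⟩ : ∃ C : ℕ, 1 ≤ C ∧ δ C * (c * (|M| + 1)) < 1 := by
    have ht : Tendsto (fun n : ℕ => δ n * (c * (|M| + 1))) atTop (𝓝 0) := by
      simpa using (hδ.tendsto_zero.comp tendsto_natCast_atTop_atTop).mul_const (c * (|M| + 1))
    obtain ⟨C, h1, h2⟩ := ((eventually_ge_atTop 1).and (ht.eventually_lt_const one_pos)).exists
    exact ⟨C, h1, h2⟩
  refine ⟨C, fun a b ha h => ?_⟩
  by_contra! hlt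
  have h1 : δ b < δ (C * a) := hδ.strictAnti (by exact_mod_cast hlt)
  have h2 := hmul C a (by omega) (by omega)
  rw [div_le_iff₀ (hδ.pos b)] at h
  have ha0 := hδ.pos a
  have hb0 := hδ.pos b
  have h3 : δ a ≤ (|M| + 1) * δ b := by nlinarith [le_abs_self M]
  have h4 : (|M| + 1) * δ b ≤ (|M| + 1) * (c * δ C * δ a) := by gcongr; linarith
  nlinarith

theorem IsWeightFunction.exists_div_le {δ : ℤ → ℝ} (hδ : IsWeightFunction δ) (C : ℝ) :
    ∃ M : ℝ, ∀ a b : ℕ, (b : ℝ) ≤ C * a → δ a / δ b ≤ M := by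
  obtain ⟨c, hc, h2⟩ := hδ.le_two_mul
  obtain ⟨k, hk⟩ := pow_unbounded_of_one_lt C (one_lt_two : (1 : ℝ) < 2)
  have hpow : ∀ k : ℕ, ∀ a : ℤ, c ^ k * δ a ≤ δ (2 ^ k * a) := by
    intro k a
    induction k with
    | zero => simp
    | succ k ih =>
      calc c ^ (k + 1) * δ a = c * (c ^ k * δ a) := by ring
        _ ≤ c * δ (2 ^ k * a) := by gcongr
        _ ≤ δ (2 * (2 ^ k * a)) := h2 _
        _ = δ (2 ^ (k + 1) * a) := by congr 1; ring
  refine ⟨(c ^ k)⁻¹, fun a b hab => ?_⟩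
  have h3 : (b : ℝ) ≤ ((2 ^ k * a : ℕ) : ℝ) := by
    push_cast
    exact hab.trans (by gcongr)
  have h4 : (b : ℤ) ≤ 2 ^ k * a := by exact_mod_cast h3
  have h5 := (hpow k a).trans (hδ.strictAnti.antitone h4)
  rw [div_le_iff₀ (hδ.pos b), ← div_eq_inv_mul, le_div_iff₀ (by positivity)]
  linarith

theorem HasBoundedWeightRatio.isBadlyApproximable {α : ℝ} (hα : Irrational α) (hα0 : 0 < α)
    (hα1 : α < 1) {δ : ℤ → ℝ} (hδ : IsWeightFunction δ)
    (h : HasBoundedWeightRatio (sturmianSubshift α) δ) : IsBadlyApproximable α := by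
  obtain ⟨M, hM⟩ := h
  obtain ⟨C, hC⟩ := hδ.exists_le_mul M
  refine isBadlyApproximable_of_length_phiZero_le hα hα0 hα1 (C := C) fun u hu hu0 => ?_
  exact_mod_cast hC u.length _ (List.length_pos_iff.2 hu0) (hM ⟨u, hu, rfl⟩)

theorem IsLinearlyRecurrent.hasBoundedWeightRatio {α : ℝ} (hα : Irrational α) (hα0 : 0 < α)
    (hα1 : α < 1) {δ : ℤ → ℝ} (hδ : IsWeightFunction δ)
    (h : IsLinearlyRecurrent (sturmianSubshift α)) :
    HasBoundedWeightRatio (sturmianSubshift α) δ := by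
  obtain ⟨C, hC⟩ := h.exists_length_phiZero_le hα hα0 hα1
  obtain ⟨M, hM⟩ := hδ.exists_div_le C
  refine ⟨max M (δ 0 / δ ((phiZero (sturmianSubshift α) []).length : ℤ)), ?_⟩
  rintro t ⟨u, hu, rfl⟩
  rcases eq_or_ne u [] with rfl | hu0
  · exact le_max_right _ _
  · exact (hM _ _ (hC u hu.mem_language hu0)).trans (le_max_left _ _)

end SturmianWeights

open SturmianWeights in
theorem mainTheorem8 (α : ℝ) (hα : Irrational α) (hα0 : 0 < α) (hα1 : α < 1)
    (δ : ℤ → ℝ) (hδ : IsWeightFunction δ) :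
    (HasBoundedWeightRatio (sturmianSubshift α) δ ↔ IsLinearlyRecurrent (sturmianSubshift α)) ∧
      (IsLinearlyRecurrent (sturmianSubshift α) ↔ HasBoundedPartialQuotients α) := by
  have hab : HasBoundedWeightRatio (sturmianSubshift α) δ → HasBoundedPartialQuotients α :=
    fun h => (h.isBadlyApproximable hα hα0 hα1 hδ).hasBoundedPartialQuotients hα
  have hca : IsLinearlyRecurrent (sturmianSubshift α) →
      HasBoundedWeightRatio (sturmianSubshift α) δ :=
    fun h => h.hasBoundedWeightRatio hα hα0 hα1 hδ
  have hbc : HasBoundedPartialQuotients α → IsLinearlyRecurrent (sturmianSubshift α) :=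
    fun h => h.isLinearlyRecurrent hα hα0 hα1
  exact ⟨⟨fun h => hbc (hab h), hca⟩, ⟨fun h => hab (hca h), hbc⟩⟩
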